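/- Let $F:(M^m,g_M)\to(N^n,g_N)$ be a Riemannian map between Riemannian manifolds: $F$ is smooth and, for every $q\in M$, $F_{*q}$ is isometric on $(\ker F_{*q})^\perp$. Let $\nabla^N$ be the Levi-Civita connection of $N$ and $R^N(X,Y)Z=\nabla^N_X\nabla^N_YZ-\nabla^N_Y\nabla^N_XZ-\nabla^N_{[X,Y]}Z$, $Ric(X,Y)=\operatorname{trace}(Z\mapsto R^N(Z,X)Y)$, $s^N=\operatorname{trace}Ric$. For a subspace $K\subseteq T_yN$ with orthogonal projection $P_K$ put $R^K(u,v)w=P_K\big(R^N(u,v)w\big)$ and $Ric^K(v,w)=\operatorname{trace}(z\mapsto R^K(z,v)w)$ for $u,v,w\in K$ (trace over $K$), and $s^K=\operatorname{trace}Ric^K$; for $K=range F_{*}$ and $K=(range F_{*})^\perp$ this defines $s^{range F_*}$ and $s^{(range F_*)^\perp}$. Let $O\subseteq M$ and $U\subseteq N$ be open with $F(O)\subseteq U$, and let $D$ be a smooth distribution on $U$ extending $range F_*$, that is, $D_{F(q)}=range F_{*q}$ for all $q\in O$. Assume that $(range F_*)^\perp$ is totally geodesic: for all smooth sections $V,W$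 of $D^\perp$ over $U$, $\nabla^N_VW$ lies in $D^\perp$ at every point of $F(O)$. For $X$ a section of $D$ and $U_1,V$ sections of $D^\perp$, let $\mathcal S_VX$ be minus the $D$-component of $\nabla^N_XV$, and $\nabla^{F\perp}_{U_1}V$ the $D^\perp$-component of $\nabla^N_{U_1}V$. Let $\{F_*X_j\}_{r+1\le j\le m}$ be a smooth orthonormal frame of $D$ over $U$ which at $F(q)$, $q\in O$, is $F_{*q}(X_j(q))$ for smooth sections $X_j$ of $(\ker F_*)^\perp$ over $O$, and let $\{e_k\}_{1\le k\le n_1}$ be a smooth orthonormal frame of $D^\perp$ over $U$. Then, at every point of $F(O)$, $$\begin{aligned} s^N={}&s^{range F_*}+s^{(range F_*)^\perp}-2\sum_{j=r+1}^{m}\sum_{k=1}^{n_1}g_N\big(\mathcal S_{\nabla^{F\perp}_{e_k}e_k}F_*X_j,F_*X_j\big)+\sum_{j=r+1}^{m}\sum_{k=1}^{n_1}g_N\big(\nabla^N_{e_k}\mathcal S_{e_k}F_*X_j,F_*X_j\big)\\ &-2\sum_{j=r+1}^{m}\sum_{k=1}^{n_1}g_N\big(\mathcal S_{e_k}F_*X_j,\mathcal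 S_{e_k}F_*X_j\big)-3\sum_{j=r+1}^{m}\sum_{k=1}^{n_1}g_N\big(\nabla^N_{e_k}F_*X_j,\mathcal S_{e_k}F_*X_j\big)\\ &+\sum_{j=r+1}^{m}\sum_{k=1}^{n_1}e_k\big(g_N(\mathcal S_{e_k}F_*X_j,F_*X_j)\big). \end{aligned}$$ -/

import Mathlib

open Set Bundle
open scoped Manifold ContDiff Topology

noncomputable section

namespace RiemMap

section Geometry

variable {E : Type*} [NormedAddCommGroup E] [NormedSpace ℝ E] [FiniteDimensional ℝ E]
  {H : Type*} [TopologicalSpace H] (I : ModelWithCorners ℝ E H)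
  (N : Type*) [TopologicalSpace N] [ChartedSpace H N]

/-- (Not necessarily smooth) vector fields on `N`. -/
abbrev VField : Type _ := (y : N) → TangentSpace I y

/-- Distributions on `N`: a subspace of each tangent space. -/
abbrev Distribution : Type _ := (y : N) → Submodule ℝ (TangentSpace I y)

variable {I N}

/-- The vector field `X` is smooth on the set `U`. -/
def SmoothFieldOn [IsManifold I ∞ N] (X : VField I N) (U : Set N) : Prop :=
  ContMDiffOn I (I.prod 𝓘(ℝ, E)) ∞ (fun y => (⟨y, X y⟩ : TangentBundle I N)) U

variable [IsManifold I ∞ N]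
  [RiemannianBundle (fun y : N => TangentSpace I y)]
  [IsContMDiffRiemannianBundle I ∞ E (fun y : N => TangentSpace I y)]

/-- `nabla` is the Levi-Civita connection of the Riemannian manifold `N`: a smooth connection on
`TN` (it maps smooth local fields to smooth local tensor fields) which is compatible with the
metric and torsion-free. In Mathlib's convention `nabla Y y (X y)` is `(∇_X Y)(y)`. -/
structure IsLeviCivita
    (nabla : CovariantDerivative I E (fun y : N => TangentSpace I y)) : Prop where
  smooth : ∀ U : Set N, IsOpen U → ContMDiffCovariantDerivativeOn E ∞ nabla.toFun U
  metric : ∀ (y : N) (Y Z : VField I N),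
    MDifferentiableAt I (I.prod 𝓘(ℝ, E)) (fun z => (⟨z, Y z⟩ : TangentBundle I N)) y →
    MDifferentiableAt I (I.prod 𝓘(ℝ, E)) (fun z => (⟨z, Z z⟩ : TangentBundle I N)) y →
    ∀ v : TangentSpace I y, mvfderiv I (fun z => (inner ℝ (Y z) (Z z) : ℝ)) y v
      = inner ℝ (nabla Y y v) (Z y) + inner ℝ (Y y) (nabla Z y v)
  torsion_free : nabla.torsion = 0

variable (nabla : CovariantDerivative I E (fun y : N => TangentSpace I y))

/-- The vector field `∇_X Y`. -/
def covD (X Y : VField I N) : VField I N := fun y => nabla Y y (X y)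

/-- The curvature `R(X, Y)Z = ∇_X ∇_Y Z - ∇_Y ∇_X Z - ∇_{[X, Y]} Z` on vector fields. -/
def curvatureField (X Y Z : VField I N) : VField I N :=
  covD nabla X (covD nabla Y Z) - covD nabla Y (covD nabla X Z)
    - covD nabla (VectorField.mlieBracket I X Y) Z

/-- The curvature tensor `R(u, v)w` on tangent vectors at `y`: the vectors are extended to vector
fields which are smooth near `y` (constant in the preferred trivialization at `y`); the value does
not depend on the smooth extension, as the curvature is a tensor. -/
def curvature (y : N) (u v w : TangentSpace I y) : TangentSpace I y :=
  curvatureField nabla (FiberBundle.extend E u) (FiberBundle.extend E v)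
    (FiberBundle.extend E w) y

/-- The Ricci tensor `Ric(v, w) = trace (z ↦ R(z, v)w)`, computed in an orthonormal basis. -/
def ricci (y : N) (v w : TangentSpace I y) : ℝ :=
  haveI : FiniteDimensional ℝ (TangentSpace I y) := inferInstanceAs (FiniteDimensional ℝ E)
  let b := stdOrthonormalBasis ℝ (TangentSpace I y)
  ∑ i, inner ℝ (curvature nabla y (b i) v w) (b i)

/-- The scalar curvature, the trace of the Ricci tensor. -/
def scalarCurvature (y : N) : ℝ :=
  haveI : FiniteDimensional ℝ (TangentSpace I y) := inferInstanceAs (FiniteDimensional ℝ E)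
  let b := stdOrthonormalBasis ℝ (TangentSpace I y)
  ∑ i, ricci nabla y (b i) (b i)

/-- The orthogonal projection of `T_y N` onto a subspace `K`, as a vector of `T_y N`. -/
def proj {y : N} (K : Submodule ℝ (TangentSpace I y)) (v : TangentSpace I y) :
    TangentSpace I y :=
  haveI : FiniteDimensional ℝ (TangentSpace I y) := inferInstanceAs (FiniteDimensional ℝ E)
  K.starProjection v

/-- The curvature of a distribution at `y`, where `K ⊆ T_y N` is its fibre: the component in `K`
of `R(u, v)w`, for `u, v, w ∈ K`. -/
def curvatureOf {y : N} (K : Submodule ℝ (TangentSpace I y)) (u v w : K) :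
    TangentSpace I y :=
  proj K (curvature nabla y u v w)

/-- The Ricci tensor of a distribution with fibre `K` at `y`: `trace (z ↦ R^K(z, v)w)` over `K`. -/
def ricciOf {y : N} (K : Submodule ℝ (TangentSpace I y)) (v w : K) : ℝ :=
  haveI : FiniteDimensional ℝ (TangentSpace I y) := inferInstanceAs (FiniteDimensional ℝ E)
  let b := stdOrthonormalBasis ℝ K
  ∑ i, inner ℝ (curvatureOf nabla K (b i) v w) (b i : TangentSpace I y)

/-- The scalar curvature of a distribution with fibre `K` at `y`: the trace of its Ricci tensor. -/
def scalarCurvatureOf {y : N} (K : Submodule ℝ (TangentSpace I y)) : ℝ :=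
  haveI : FiniteDimensional ℝ (TangentSpace I y) := inferInstanceAs (FiniteDimensional ℝ E)
  let b := stdOrthonormalBasis ℝ K
  ∑ i, ricciOf nabla K (b i) (b i)

variable (D : Distribution I N)

/-- The orthogonal complement of a distribution. -/
def orthCompl : Distribution I N := fun y => (D y)ᗮ

/-- For `X` a section of `D` and `V` a section of `D^⊥`, the field `S_V X`: minus the component
of `∇_X V` in `D`. -/
def shape (V X : VField I N) : VField I N := fun y => - proj (D y) (covD nabla X V y)

/-- The connection `∇^⊥_U V` on `D^⊥`: the component of `∇_U V` in `D^⊥`. -/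
def covDPerp (U V : VField I N) : VField I N := fun y => proj (orthCompl D y) (covD nabla U V y)

/-- The derivative `V(f)` of a real function along a vector field, at `y`. -/
def dirDeriv (V : VField I N) (f : N → ℝ) (y : N) : ℝ := mvfderiv I f y (V y)

/-- The inner product of two vector fields, as a function. -/
def ip (X Y : VField I N) (y : N) : ℝ := inner ℝ (X y) (Y y)

/-- The distribution `K` is totally geodesic at the points of `A`: `∇_V W` lies in `K` at the
points of `A`, for all smooth sections `V`, `W` of `K` over the open set `U ⊇ A`. -/
def TotallyGeodesicAlong (K : Distribution I N) (U A : Set N) : Prop :=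
  ∀ V W : VField I N, SmoothFieldOn V U → SmoothFieldOn W U →
    (∀ y ∈ U, V y ∈ K y) → (∀ y ∈ U, W y ∈ K y) → ∀ y ∈ A, covD nabla V W y ∈ K y

/-- The fields `e i` form a smooth orthonormal frame of the distribution `K` over `U`. -/
structure IsOrthonormalFrameOn {ι : Type*} (e : ι → VField I N) (K : Distribution I N)
    (U : Set N) : Prop where
  smooth : ∀ i, SmoothFieldOn (e i) U
  orthonormal : ∀ y ∈ U, Orthonormal ℝ (fun i => e i y)
  span_eq : ∀ y ∈ U, Submodule.span ℝ (range fun i => e i y) = K y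

end Geometry

section Maps

variable {E : Type*} [NormedAddCommGroup E] [NormedSpace ℝ E]
  {H : Type*} [TopologicalSpace H] {I : ModelWithCorners ℝ E H}
  {M : Type*} [TopologicalSpace M] [ChartedSpace H M]
  [RiemannianBundle (fun x : M => TangentSpace I x)]
  {E' : Type*} [NormedAddCommGroup E'] [NormedSpace ℝ E']
  {H' : Type*} [TopologicalSpace H'] {I' : ModelWithCorners ℝ E' H'}
  {N : Type*} [TopologicalSpace N] [ChartedSpace H' N]
  [RiemannianBundle (fun y : N => TangentSpace I' y)]

variable (I I') in
/-- The differential `F_* : T_q M → T_{F q} N` as a linear map. -/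
def diffMap (F : M → N) (q : M) : TangentSpace I q →ₗ[ℝ] TangentSpace I' (F q) :=
  (mfderiv I I' F q).toLinearMap

variable (I I') in
/-- Riemannian maps: smooth maps whose differential at each point is isometric on the horizontal
space `(ker F_*)^⊥`. -/
structure IsRiemannianMap (F : M → N) : Prop where
  smooth : ContMDiff I I' ∞ F
  isometric : ∀ q : M, ∀ v ∈ (diffMap I I' F q).kerᗮ, ∀ w ∈ (diffMap I I' F q).kerᗮ,
    inner ℝ (diffMap I I' F q v) (diffMap I I' F q w) = inner ℝ v w

end Maps

end RiemMap

end

set_option linter.unusedSectionVars false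

section LieBracketDerivation

open VectorField

variable {E : Type*} [NormedAddCommGroup E] [NormedSpace ℝ E]
  {H : Type*} [TopologicalSpace H] {I : ModelWithCorners ℝ E H}
  {N : Type*} [TopologicalSpace N] [ChartedSpace H N] [IsManifold I 2 N]
  {G : Type*} [NormedAddCommGroup G] [NormedSpace ℝ G]

/-- The derivative of a function along a vector field, read in a chart. -/
lemma fderivWithin_comp_extChartAt_symm_mpullbackWithin {φ : N → G} {x : N} {z : E}
    (hz : z ∈ (extChartAt I x).target)
    (hφ : MDifferentiableAt I 𝓘(ℝ, G) φ ((extChartAt I x).symm z))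
    (X : (y : N) → TangentSpace I y) :
    fderivWithin ℝ (φ ∘ (extChartAt I x).symm) (range I) z
        (mpullbackWithin 𝓘(ℝ, E) I (extChartAt I x).symm X (range I) z)
      = mvfderiv I φ ((extChartAt I x).symm z) (X ((extChartAt I x).symm z)) := by
  have : IsManifold I 1 N := .of_le one_le_two
  have hinv := isInvertible_mfderivWithin_extChartAt_symm hz
  have hzr : z ∈ range I := extChartAt_target_subset_range x hz
  have hu : UniqueMDiffWithinAt 𝓘(ℝ, E) (range I) z :=
    (I.uniqueDiffOn z hzr).uniqueMDiffWithinAt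
  have h := mfderiv_comp_mfderivWithin z hφ (mdifferentiableWithinAt_extChartAt_symm hz) hu
  rw [mfderivWithin_eq_fderivWithin] at h
  rw [h]
  simp only [mpullbackWithin_apply]
  change (mfderiv I 𝓘(ℝ, G) φ ((extChartAt I x).symm z))
    ((mfderivWithin 𝓘(ℝ, E) I (extChartAt I x).symm (range I) z)
      ((mfderivWithin 𝓘(ℝ, E) I (extChartAt I x).symm (range I) z).inverse _)) = _
  rw [hinv.self_apply_inverse]
  rfl


/-- Eventual version of `fderivWithin_comp_extChartAt_symm_mpullbackWithin`. -/
lemma eventually_fderivWithin_comp_extChartAt_symm_mpullbackWithin {φ : N → G} {x : N}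
    (hφ : ContMDiffAt I 𝓘(ℝ, G) 2 φ x) (X : (y : N) → TangentSpace I y) :
    (fun z => mvfderiv I φ z (X z)) ∘ (extChartAt I x).symm
      =ᶠ[𝓝[range I] (extChartAt I x x)]
      fun z => fderivWithin ℝ (φ ∘ (extChartAt I x).symm) (range I) z
        (mpullbackWithin 𝓘(ℝ, E) I (extChartAt I x).symm X (range I) z) := by
  have : IsManifold I 1 N := .of_le one_le_two
  have h1 : ∀ᶠ y in 𝓝 x, MDifferentiableAt I 𝓘(ℝ, G) φ y :=
    ((contMDiffAt_iff_contMDiffAt_nhds (by simp)).1 hφ).mono fun y hy => hy.mdifferentiableAt two_ne_zero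
  have hc : Filter.Tendsto (extChartAt I x).symm (𝓝 (extChartAt I x x)) (𝓝 x) := by
    have := continuousAt_extChartAt_symm (I := I) x
    rwa [ContinuousAt, extChartAt_to_inv] at this
  filter_upwards [(hc.mono_left nhdsWithin_le_nhds).eventually h1,
    extChartAt_target_mem_nhdsWithin (I := I) x] with z hz hzt
  exact (fderivWithin_comp_extChartAt_symm_mpullbackWithin hzt hz X).symm

variable [CompleteSpace E]

lemma differentiableWithinAt_fderivWithin_mpullbackWithin {φ : N → G} {x : N}
    (hφ : ContMDiffAt I 𝓘(ℝ, G) 2 φ x) {X : (y : N) → TangentSpace I y}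
    (hX : MDifferentiableAt I I.tangent (fun y => (⟨y, X y⟩ : TangentBundle I N)) x) :
    DifferentiableWithinAt ℝ
      (fun z => fderivWithin ℝ (φ ∘ (extChartAt I x).symm) (range I) z
        (mpullbackWithin 𝓘(ℝ, E) I (extChartAt I x).symm X (range I) z))
      (range I) (extChartAt I x x) := by
  have hφ' : ContDiffWithinAt ℝ 2 (φ ∘ (extChartAt I x).symm) (range I) (extChartAt I x x) :=
    (contMDiffAt_iff.1 hφ).2
  have hX' := (mdifferentiableWithinAt_univ.2 hX).differentiableWithinAt_mpullbackWithin_vectorField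
  rw [preimage_univ, univ_inter] at hX'
  exact ((hφ'.fderivWithin_right I.uniqueDiffOn (m := 1) (by norm_num)
    (mem_range_self _)).differentiableWithinAt one_ne_zero).clm_apply hX'

/-- The derivative of a `C^2` function along a differentiable vector field is differentiable. -/
lemma mdifferentiableAt_mvfderiv_apply {φ : N → G} {x : N}
    (hφ : ContMDiffAt I 𝓘(ℝ, G) 2 φ x) {X : (y : N) → TangentSpace I y}
    (hX : MDifferentiableAt I I.tangent (fun y => (⟨y, X y⟩ : TangentBundle I N)) x) :
    MDifferentiableAt I 𝓘(ℝ, G) (fun z => mvfderiv I φ z (X z)) x := by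
  have : IsManifold I 1 N := .of_le one_le_two
  rw [mdifferentiableAt_iff_source_of_mem_source (x := x) (mem_chart_source H x)]
  refine ((differentiableWithinAt_fderivWithin_mpullbackWithin hφ hX).congr_of_eventuallyEq
    (eventually_fderivWithin_comp_extChartAt_symm_mpullbackWithin hφ X)
    ?_).mdifferentiableWithinAt
  exact (eventually_fderivWithin_comp_extChartAt_symm_mpullbackWithin hφ X).self_of_nhdsWithin
    (mem_range_self _)

/-- The derivation along a Lie bracket is the commutator of the derivations. -/
theorem mvfderiv_mlieBracket {φ : N → G} {x : N}
    (hφ : ContMDiffAt I 𝓘(ℝ, G) 2 φ x) {X Y : (y : N) → TangentSpace I y}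
    (hX : MDifferentiableAt I I.tangent (fun y => (⟨y, X y⟩ : TangentBundle I N)) x)
    (hY : MDifferentiableAt I I.tangent (fun y => (⟨y, Y y⟩ : TangentBundle I N)) x) :
    mvfderiv I φ x (mlieBracket I X Y x)
      = mvfderiv I (fun z => mvfderiv I φ z (Y z)) x (X x)
        - mvfderiv I (fun z => mvfderiv I φ z (X z)) x (Y x) := by
  have : IsManifold I 1 N := .of_le one_le_two
  have hmem := mem_extChartAt_target (I := I) x
  have key {ψ : N → G} (hψ : MDifferentiableAt I 𝓘(ℝ, G) ψ x) (Z : (y : N) → TangentSpace I y) :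
      fderivWithin ℝ (ψ ∘ (extChartAt I x).symm) (range I) (extChartAt I x x)
        (mpullbackWithin 𝓘(ℝ, E) I (extChartAt I x).symm Z (range I) (extChartAt I x x))
        = mvfderiv I ψ x (Z x) := by
    have h := fderivWithin_comp_extChartAt_symm_mpullbackWithin hmem
      (by rwa [extChartAt_to_inv]) Z
    rwa [extChartAt_to_inv] at h
  have hφ' : ContDiffWithinAt ℝ 2 (φ ∘ (extChartAt I x).symm) (range I) (extChartAt I x x) :=
    (contMDiffAt_iff.1 hφ).2
  have hdiff {Z : (y : N) → TangentSpace I y}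
      (hZ : MDifferentiableAt I I.tangent (fun y => (⟨y, Z y⟩ : TangentBundle I N)) x) := by
    simpa only [preimage_univ, univ_inter] using
      (mdifferentiableWithinAt_univ.2 hZ).differentiableWithinAt_mpullbackWithin_vectorField
  have hbr := VectorField.fderivWithin_apply_lieBracket hφ' (by simp) I.uniqueDiffOn
    (I.range_subset_closure_interior (mem_range_self _)) (mem_range_self _) (hdiff hY) (hdiff hX)
  have hpull : mpullbackWithin 𝓘(ℝ, E) I (extChartAt I x).symm (mlieBracket I X Y) (range I)
      (extChartAt I x x) = lieBracketWithin ℝ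
        (mpullbackWithin 𝓘(ℝ, E) I (extChartAt I x).symm X (range I))
        (mpullbackWithin 𝓘(ℝ, E) I (extChartAt I x).symm Y (range I))
        (range I) (extChartAt I x x) := by
    rw [mpullbackWithin_apply, extChartAt_to_inv]
    refine (mfderivWithin_extChartAt_symm_inverse_apply (I := I) _).trans ?_
    rw [← mlieBracketWithin_univ, mlieBracketWithin_apply, preimage_univ, univ_inter,
      mfderiv_extChartAt_self]
    exact DFunLike.congr_fun (ContinuousLinearMap.inverse_id (R := ℝ) (M := E)) _
  have hfd (Z : (y : N) → TangentSpace I y) :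
      fderivWithin ℝ ((fun z => mvfderiv I φ z (Z z)) ∘ (extChartAt I x).symm) (range I)
        (extChartAt I x x) = _ :=
    (eventually_fderivWithin_comp_extChartAt_symm_mpullbackWithin hφ Z).fderivWithin_eq_of_mem
      (mem_range_self _)
  rw [← key (hφ.mdifferentiableAt two_ne_zero), hpull, hbr,
    ← key (mdifferentiableAt_mvfderiv_apply hφ hY), ← key (mdifferentiableAt_mvfderiv_apply hφ hX),
    hfd, hfd]

variable {E' : Type*} [NormedAddCommGroup E'] [NormedSpace ℝ E'] [CompleteSpace E']
  {H' : Type*} [TopologicalSpace H'] {I' : ModelWithCorners ℝ E' H'}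
  {M : Type*} [TopologicalSpace M] [ChartedSpace H' M] [IsManifold I' 2 M]

/-- The Lie bracket of related vector fields is related to the Lie bracket. -/
theorem mlieBracket_eq_mfderiv_mlieBracket_of_related {F : M → N} {q : M}
    (hF : ContMDiffAt I' I 2 F q)
    {A B : (x : M) → TangentSpace I' x} {X Y : (y : N) → TangentSpace I y}
    (hA : MDifferentiableAt I' I'.tangent (fun x => (⟨x, A x⟩ : TangentBundle I' M)) q)
    (hB : MDifferentiableAt I' I'.tangent (fun x => (⟨x, B x⟩ : TangentBundle I' M)) q)
    (hX : MDifferentiableAt I I.tangent (fun y => (⟨y, X y⟩ : TangentBundle I N)) (F q))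
    (hY : MDifferentiableAt I I.tangent (fun y => (⟨y, Y y⟩ : TangentBundle I N)) (F q))
    (hAX : ∀ᶠ x in 𝓝 q, X (F x) = mfderiv I' I F x (A x))
    (hBY : ∀ᶠ x in 𝓝 q, Y (F x) = mfderiv I' I F x (B x)) :
    mlieBracket I X Y (F q) = mfderiv I' I F q (mlieBracket I' A B q) := by
  have : IsManifold I 1 N := .of_le one_le_two
  have : IsManifold I' 1 M := .of_le one_le_two
  let φ : N → E := fun y => extChartAt I (F q) y
  have hφ : ContMDiffAt I 𝓘(ℝ, E) 2 φ (F q) := contMDiffAt_extChartAt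
  have hφF : ContMDiffAt I' 𝓘(ℝ, E) 2 (φ ∘ F) q := hφ.comp q hF
  have hFd := hF.mdifferentiableAt two_ne_zero
  have hchain {ψ : N → E} {x : M} (hψ : MDifferentiableAt I 𝓘(ℝ, E) ψ (F x))
      (hx : MDifferentiableAt I' I F x) :
      mvfderiv I' (ψ ∘ F) x = (mvfderiv I ψ (F x)).comp (mfderiv I' I F x) :=
    mfderiv_comp x hψ hx
  have hcomp {Z : (y : N) → TangentSpace I y} {C : (x : M) → TangentSpace I' x}
      (hCZ : ∀ᶠ x in 𝓝 q, Z (F x) = mfderiv I' I F x (C x)) :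
      (fun x => mvfderiv I' (φ ∘ F) x (C x)) =ᶠ[𝓝 q] (fun y => mvfderiv I φ y (Z y)) ∘ F := by
    have h1 : ∀ᶠ x in 𝓝 q, MDifferentiableAt I' I F x :=
      ((contMDiffAt_iff_contMDiffAt_nhds (by simp)).1 hF).mono
        fun y hy => hy.mdifferentiableAt two_ne_zero
    have h2 : ∀ᶠ y in 𝓝 (F q), MDifferentiableAt I 𝓘(ℝ, E) φ y :=
      ((contMDiffAt_iff_contMDiffAt_nhds (by simp)).1 hφ).mono
        fun y hy => hy.mdifferentiableAt two_ne_zero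
    filter_upwards [hCZ, h1, hF.continuousAt.eventually h2] with x hx hx1 hx2
    rw [hchain hx2 hx1, Function.comp_apply, hx]
    rfl
  have hderiv {Z Z' : (y : N) → TangentSpace I y} {C C' : (x : M) → TangentSpace I' x}
      (hZ : MDifferentiableAt I I.tangent (fun y => (⟨y, Z y⟩ : TangentBundle I N)) (F q))
      (hCZ : ∀ᶠ x in 𝓝 q, Z (F x) = mfderiv I' I F x (C x))
      (hCZ' : ∀ᶠ x in 𝓝 q, Z' (F x) = mfderiv I' I F x (C' x)) :
      mvfderiv I' (fun x => mvfderiv I' (φ ∘ F) x (C x)) q (C' q)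
        = mvfderiv I (fun y => mvfderiv I φ y (Z y)) (F q) (Z' (F q)) := by
    have h := (hcomp hCZ).mfderiv_eq (I := I') (I' := 𝓘(ℝ, E))
    have h' := hchain (mdifferentiableAt_mvfderiv_apply hφ hZ) hFd
    have : mvfderiv I' (fun x => mvfderiv I' (φ ∘ F) x (C x)) q
        = mvfderiv I' ((fun y => mvfderiv I φ y (Z y)) ∘ F) q := by
      ext v
      exact DFunLike.congr_fun h v
    rw [this, h', hCZ'.self_of_nhds]
    rfl
  have h1 := mvfderiv_mlieBracket hφ hX hY
  have h2 := mvfderiv_mlieBracket hφF hA hB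
  rw [hderiv hY hBY hAX, hderiv hX hAX hBY, ← h1, hchain
    (hφ.mdifferentiableAt two_ne_zero) hFd] at h2
  have hinj : Function.Injective (mvfderiv I φ (F q)) :=
    (isInvertible_mfderiv_extChartAt (mem_extChartAt_source (I := I) (F q))).injective
  exact (hinj h2).symm

end LieBracketDerivation

namespace RiemMap

section Connection

open VectorField

variable {E : Type*} [NormedAddCommGroup E] [NormedSpace ℝ E] [FiniteDimensional ℝ E]
  {H : Type*} [TopologicalSpace H] {I : ModelWithCorners ℝ E H}
  {N : Type*} [TopologicalSpace N] [ChartedSpace H N] [IsManifold I ∞ N]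
  {U : Set N} {y : N} {X Y Z W : VField I N}

lemma SmoothFieldOn.contMDiffAt (hX : SmoothFieldOn X U) (hU : IsOpen U) (hy : y ∈ U) :
    CMDiffAt ∞ (T% X) y :=
  ContMDiffOn.contMDiffAt hX (hU.mem_nhds hy)

lemma SmoothFieldOn.mdifferentiableAt (hX : SmoothFieldOn X U) (hU : IsOpen U) (hy : y ∈ U) :
    MDiffAt (T% X) y :=
  (hX.contMDiffAt hU hy).mdifferentiableAt (by simp)

lemma SmoothFieldOn.congr (hX : SmoothFieldOn X U) (h : ∀ y ∈ U, Y y = X y) :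
    SmoothFieldOn Y U :=
  ContMDiffOn.congr hX fun y hy => by rw [h y hy]

lemma SmoothFieldOn.mono {V : Set N} (hX : SmoothFieldOn X U) (h : V ⊆ U) : SmoothFieldOn X V :=
  ContMDiffOn.mono hX h

lemma SmoothFieldOn.neg (hX : SmoothFieldOn X U) : SmoothFieldOn (fun y => -X y) U :=
  ContMDiffOn.neg_section hX

lemma SmoothFieldOn.smul {f : N → ℝ} (hf : ContMDiffOn I 𝓘(ℝ) ∞ f U) (hX : SmoothFieldOn X U) :
    SmoothFieldOn (fun y => f y • X y) U :=
  ContMDiffOn.smul_section hf hX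

lemma SmoothFieldOn.sum {ι : Type*} [Fintype ι] {X : ι → VField I N}
    (hX : ∀ i, SmoothFieldOn (X i) U) : SmoothFieldOn (fun y => ∑ i, X i y) U :=
  ContMDiffOn.sum_section fun i _ => hX i

/-- The standard extension of a tangent vector is smooth near the base point. -/
lemma exists_isOpen_smoothFieldOn_extend (u : TangentSpace I y) :
    ∃ U : Set N, IsOpen U ∧ y ∈ U ∧ SmoothFieldOn (FiberBundle.extend E u) U := by
  obtain ⟨s, hs, h⟩ := FiberBundle.exists_contMDiffOn_extend (k := ∞) I E u
  obtain ⟨U, hUs, hU, hy⟩ := mem_nhds_iff.1 hs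
  exact ⟨U, hU, hy, ContMDiffOn.mono h hUs⟩

variable [RiemannianBundle (fun y : N => TangentSpace I y)]
  [IsContMDiffRiemannianBundle I ∞ E (fun y : N => TangentSpace I y)]
  {nabla : CovariantDerivative I E (fun y : N => TangentSpace I y)}

lemma SmoothFieldOn.ip (hX : SmoothFieldOn X U) (hY : SmoothFieldOn Y U) :
    ContMDiffOn I 𝓘(ℝ) ∞ (ip X Y) U :=
  ContMDiffOn.inner_bundle hX hY

lemma mdifferentiableAt_ip (hX : MDiffAt (T% X) y) (hY : MDiffAt (T% Y) y) :
    MDifferentiableAt I 𝓘(ℝ) (ip X Y) y :=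
  MDifferentiableAt.inner_bundle hX hY

namespace IsLeviCivita


lemma contMDiffOn_nabla (h : IsLeviCivita nabla) (hU : IsOpen U) (hY : SmoothFieldOn Y U) :
    ContMDiffOn I (I.prod 𝓘(ℝ, E →L[ℝ] E)) ∞
      (fun y => (⟨y, nabla Y y⟩ :
        TotalSpace (E →L[ℝ] E) fun y : N => TangentSpace I y →L[ℝ] TangentSpace I y)) U :=
  (h.smooth U hU).contMDiff hY

lemma smoothFieldOn_covD (h : IsLeviCivita nabla) (hU : IsOpen U) (hX : SmoothFieldOn X U) (hY : SmoothFieldOn Y U) :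
    SmoothFieldOn (covD nabla X Y) U :=
  ContMDiffOn.clm_bundle_apply (h.contMDiffOn_nabla hU hY) hX

lemma mdifferentiableAt_covD (h : IsLeviCivita nabla) (hU : IsOpen U) (hy : y ∈ U) (hX : MDiffAt (T% X) y)
    (hY : SmoothFieldOn Y U) : MDiffAt (T% (covD nabla X Y)) y :=
  MDifferentiableAt.clm_bundle_apply
    (((h.contMDiffOn_nabla hU hY).contMDiffAt (hU.mem_nhds hy)).mdifferentiableAt (by simp)) hX

lemma covD_sub_covD (h : IsLeviCivita nabla) (hX : MDiffAt (T% X) y) (hY : MDiffAt (T% Y) y) :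
    covD nabla X Y y - covD nabla Y X y = mlieBracket I X Y y :=
  (CovariantDerivative.torsion_eq_zero_iff nabla).1 h.torsion_free hX hY

lemma mvfderiv_ip (h : IsLeviCivita nabla) (hY : MDiffAt (T% Y) y) (hZ : MDiffAt (T% Z) y) (v : TangentSpace I y) :
    mvfderiv I (ip Y Z) y v = inner ℝ (nabla Y y v) (Z y) + inner ℝ (Y y) (nabla Z y v) :=
  h.metric y Y Z hY hZ v

end IsLeviCivita

lemma nabla_add (hX : MDiffAt (T% X) y) (hY : MDiffAt (T% Y) y) :
    nabla (X + Y) y = nabla X y + nabla Y y :=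
  nabla.isCovariantDerivativeOnUniv.add hX hY

lemma nabla_smul {f : N → ℝ} (hX : MDiffAt (T% X) y) (hf : MDifferentiableAt I 𝓘(ℝ) f y) :
    nabla (f • X) y = f y • nabla X y + (mvfderiv I f y).smulRight (X y) :=
  nabla.isCovariantDerivativeOnUniv.leibniz hX hf

section Curvature


lemma curvatureField_apply (X Y Z : VField I N) (y : N) :
    curvatureField nabla X Y Z y = nabla (covD nabla Y Z) y (X y) - nabla (covD nabla X Z) y (Y y)
      - nabla Z y (mlieBracket I X Y y) := rfl

lemma curvatureField_swap (X Y Z : VField I N) (y : N) :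
    curvatureField nabla Y X Z y = - curvatureField nabla X Y Z y := by
  rw [curvatureField_apply, curvatureField_apply, mlieBracket_swap_apply, map_neg]
  abel

lemma tensorialAt_curvatureField_left (h : IsLeviCivita nabla) (hU : IsOpen U) (hy : y ∈ U) (Y : VField I N)
    (hZ : SmoothFieldOn Z U) :
    TensorialAt I E (fun X => curvatureField nabla X Y Z y) y where
  smul {f X} hf hX := by
    have hc := h.mdifferentiableAt_covD hU hy hX hZ
    have : covD nabla (f • X) Z = f • covD nabla X Z := by
      ext1 z
      exact map_smul _ _ _
    simp only [curvatureField_apply, this, nabla_smul hc hf, mlieBracket_smul_left hf hX,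
      Pi.smul_apply', map_smul, map_add]
    simp [covD]
    module
  add {X X'} hX hX' := by
    have hc := h.mdifferentiableAt_covD hU hy hX hZ
    have hc' := h.mdifferentiableAt_covD hU hy hX' hZ
    have : covD nabla (X + X') Z = covD nabla X Z + covD nabla X' Z := by
      ext1 z
      exact map_add _ _ _
    simp only [curvatureField_apply, this, nabla_add hc hc', mlieBracket_add_left hX hX',
      Pi.add_apply, map_add]
    simp
    module

/-- The curvature is skew-symmetric in its last two arguments. -/
lemma inner_curvatureField_swap (h : IsLeviCivita nabla) (hU : IsOpen U) (hy : y ∈ U) (hX : SmoothFieldOn X U)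
    (hY : SmoothFieldOn Y U) (hZ : SmoothFieldOn Z U) (hW : SmoothFieldOn W U) :
    inner ℝ (curvatureField nabla X Y Z y) (W y)
      = - inner ℝ (curvatureField nabla X Y W y) (Z y) := by
  have hsm := (((hZ.ip hW).contMDiffAt (hU.mem_nhds hy)).of_le (m := 2) ENat.LEInfty.out)
  have hL := mvfderiv_mlieBracket hsm (hX.mdifferentiableAt hU hy) (hY.mdifferentiableAt hU hy)
  have hdd {A B : VField I N} (hA : SmoothFieldOn A U) (hB : SmoothFieldOn B U) :
      mvfderiv I (fun z => mvfderiv I (ip Z W) z (A z)) y (B y)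
        = inner ℝ (nabla (covD nabla A Z) y (B y)) (W y)
          + inner ℝ (nabla Z y (A y)) (nabla W y (B y))
          + (inner ℝ (nabla Z y (B y)) (nabla W y (A y))
          + inner ℝ (Z y) (nabla (covD nabla A W) y (B y))) := by
    have hAZ := h.smoothFieldOn_covD hU hA hZ
    have hAW := h.smoothFieldOn_covD hU hA hW
    have heq : (fun z => mvfderiv I (ip Z W) z (A z)) =ᶠ[𝓝 y]
        (ip (covD nabla A Z) W + ip Z (covD nabla A W)) := by
      filter_upwards [hU.mem_nhds hy] with z hz
      exact h.mvfderiv_ip (hZ.mdifferentiableAt hU hz) (hW.mdifferentiableAt hU hz) (A z)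
    have : mvfderiv I (fun z => mvfderiv I (ip Z W) z (A z)) y
        = mvfderiv I (ip (covD nabla A Z) W + ip Z (covD nabla A W)) y := by
      ext v
      exact DFunLike.congr_fun (heq.mfderiv_eq (I := I) (I' := 𝓘(ℝ))) v
    rw [this, mvfderiv_add
      (mdifferentiableAt_ip (hAZ.mdifferentiableAt hU hy) (hW.mdifferentiableAt hU hy))
      (mdifferentiableAt_ip (hZ.mdifferentiableAt hU hy) (hAW.mdifferentiableAt hU hy)),
      add_apply,
      h.mvfderiv_ip (hAZ.mdifferentiableAt hU hy) (hW.mdifferentiableAt hU hy),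
      h.mvfderiv_ip (hZ.mdifferentiableAt hU hy) (hAW.mdifferentiableAt hU hy)]
    rfl
  rw [hdd hY hX, hdd hX hY,
    h.mvfderiv_ip (hZ.mdifferentiableAt hU hy) (hW.mdifferentiableAt hU hy)] at hL
  simp only [curvatureField_apply, inner_sub_left]
  rw [real_inner_comm (Z y), real_inner_comm (Z y), real_inner_comm (Z y)]
  linarith [real_inner_comm (Z y) (nabla (covD nabla Y W) y (X y))]

end Curvature

end Connection

end RiemMap

lemma Orthonormal.sum_inner_smul_of_mem_span {V ι : Type*} [NormedAddCommGroup V]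
    [InnerProductSpace ℝ V] [Fintype ι] {b : ι → V} (hb : Orthonormal ℝ b) {v : V}
    (hv : v ∈ Submodule.span ℝ (range b)) : ∑ i, (inner ℝ (b i) v : ℝ) • b i = v := by
  obtain ⟨a, rfl⟩ := (Submodule.mem_span_range_iff_exists_fun ℝ).1 hv
  exact Finset.sum_congr rfl fun i _ => by rw [hb.inner_right_fintype]

/-- The trace of a bilinear form over a subspace does not depend on the orthonormal basis of the
subspace. -/
lemma Orthonormal.sum_bilin_eq_of_span_eq {V ι κ : Type*} [NormedAddCommGroup V]
    [InnerProductSpace ℝ V] [Fintype ι] [Fintype κ] {b : ι → V} {c : κ → V}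
    (hb : Orthonormal ℝ b) (hc : Orthonormal ℝ c)
    (h : Submodule.span ℝ (range b) = Submodule.span ℝ (range c)) (B : V →ₗ[ℝ] V →ₗ[ℝ] ℝ) :
    ∑ i, B (b i) (b i) = ∑ j, B (c j) (c j) := by
  have hbc (i : ι) : B (b i) (b i) = ∑ j, inner ℝ (c j) (b i) * B (c j) (b i) := by
    have hi : B (∑ j, (inner ℝ (c j) (b i) : ℝ) • c j) (b i) = B (b i) (b i) := by
      rw [hc.sum_inner_smul_of_mem_span (h ▸ Submodule.subset_span (mem_range_self i))]
    rw [← hi, map_sum, LinearMap.sum_apply]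
    exact Finset.sum_congr rfl fun j _ => by rw [map_smul, LinearMap.smul_apply, smul_eq_mul]
  have hcb (j : κ) : ∑ i, inner ℝ (c j) (b i) * B (c j) (b i) = B (c j) (c j) := by
    have hj : B (c j) (∑ i, (inner ℝ (b i) (c j) : ℝ) • b i) = B (c j) (c j) := by
      rw [hb.sum_inner_smul_of_mem_span (h ▸ Submodule.subset_span (mem_range_self j))]
    rw [← hj, map_sum]
    exact Finset.sum_congr rfl fun i _ => by rw [map_smul, smul_eq_mul, real_inner_comm]
  simp only [hbc]
  rw [Finset.sum_comm]
  exact Finset.sum_congr rfl fun j _ => hcb j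

namespace RiemMap

section CurvatureForm

variable {E : Type*} [NormedAddCommGroup E] [NormedSpace ℝ E] [FiniteDimensional ℝ E]
  {H : Type*} [TopologicalSpace H] {I : ModelWithCorners ℝ E H}
  {N : Type*} [TopologicalSpace N] [ChartedSpace H N] [IsManifold I ∞ N]
  [RiemannianBundle (fun y : N => TangentSpace I y)]
  [IsContMDiffRiemannianBundle I ∞ E (fun y : N => TangentSpace I y)]
  {nabla : CovariantDerivative I E (fun y : N => TangentSpace I y)}
  {U : Set N} {y : N} {X Y Z W : VField I N}

/-- The curvature of vector fields is a tensor. -/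
lemma curvature_eq_curvatureField (h : IsLeviCivita nabla) (hU : IsOpen U) (hy : y ∈ U)
    (hX : SmoothFieldOn X U) (hY : SmoothFieldOn Y U) (hZ : SmoothFieldOn Z U) :
    curvature nabla y (X y) (Y y) (Z y) = curvatureField nabla X Y Z y := by
  have hXe := FiberBundle.mdifferentiableAt_extend I E (X y)
  have hYe := FiberBundle.mdifferentiableAt_extend I E (Y y)
  obtain ⟨V, hV, hyV, hZV⟩ := exists_isOpen_smoothFieldOn_extend (Z y)
  have h1 : curvature nabla y (X y) (Y y) (Z y)
      = curvatureField nabla X (FiberBundle.extend E (Y y)) (FiberBundle.extend E (Z y)) y :=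
    (tensorialAt_curvatureField_left h hV hyV _ hZV).pointwise hXe (hX.mdifferentiableAt hU hy)
      (by simp)
  have h2 : curvatureField nabla X (FiberBundle.extend E (Y y)) (FiberBundle.extend E (Z y)) y
      = curvatureField nabla X Y (FiberBundle.extend E (Z y)) y := by
    rw [← neg_inj, ← curvatureField_swap, ← curvatureField_swap]
    exact (tensorialAt_curvatureField_left h hV hyV _ hZV).pointwise hYe
      (hY.mdifferentiableAt hU hy) (by simp)
  rw [h1, h2]
  refine ext_inner_right ℝ fun w => ?_
  obtain ⟨V', hV', hyV', hwV'⟩ := exists_isOpen_smoothFieldOn_extend w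
  have hO := (hU.inter hV).inter hV'
  have hyO : y ∈ U ∩ V ∩ V' := ⟨⟨hy, hyV⟩, hyV'⟩
  have sU : U ∩ V ∩ V' ⊆ U := fun z hz => hz.1.1
  have hw : FiberBundle.extend E w y = w := by simp
  rw [← hw,
    inner_curvatureField_swap h hO hyO (hX.mono sU) (hY.mono sU) (hZV.mono fun z hz => hz.1.2)
      (hwV'.mono fun z hz => hz.2),
    inner_curvatureField_swap h hO hyO (hX.mono sU) (hY.mono sU) (hZ.mono sU)
      (hwV'.mono fun z hz => hz.2)]
  simp

/-- Four tangent vectors extend to smooth fields on a common open set. -/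
lemma exists_smoothFieldOn_extensions (u v w z : TangentSpace I y) :
    ∃ U : Set N, IsOpen U ∧ y ∈ U ∧ SmoothFieldOn (FiberBundle.extend E u) U ∧
      SmoothFieldOn (FiberBundle.extend E v) U ∧ SmoothFieldOn (FiberBundle.extend E w) U ∧
      SmoothFieldOn (FiberBundle.extend E z) U := by
  obtain ⟨U₁, hU₁, h₁, hs₁⟩ := exists_isOpen_smoothFieldOn_extend u
  obtain ⟨U₂, hU₂, h₂, hs₂⟩ := exists_isOpen_smoothFieldOn_extend v
  obtain ⟨U₃, hU₃, h₃, hs₃⟩ := exists_isOpen_smoothFieldOn_extend w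
  obtain ⟨U₄, hU₄, h₄, hs₄⟩ := exists_isOpen_smoothFieldOn_extend z
  exact ⟨(U₁ ∩ U₂) ∩ (U₃ ∩ U₄), (hU₁.inter hU₂).inter (hU₃.inter hU₄), ⟨⟨h₁, h₂⟩, ⟨h₃, h₄⟩⟩,
    hs₁.mono fun x hx => hx.1.1, hs₂.mono fun x hx => hx.1.2, hs₃.mono fun x hx => hx.2.1,
    hs₄.mono fun x hx => hx.2.2⟩

lemma curvature_swap (u v w : TangentSpace I y) :
    curvature nabla y v u w = - curvature nabla y u v w :=
  curvatureField_swap _ _ _ _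

lemma inner_curvature_swap (h : IsLeviCivita nabla) (u v w z : TangentSpace I y) :
    inner ℝ (curvature nabla y u v w) z = - inner ℝ (curvature nabla y u v z) w := by
  obtain ⟨U, hU, hy, hu, hv, hw, hz⟩ := exists_smoothFieldOn_extensions u v w z
  simpa [curvature] using inner_curvatureField_swap h hU hy hu hv hw hz

lemma curvature_add_left (h : IsLeviCivita nabla) (u u' v w : TangentSpace I y) :
    curvature nabla y (u + u') v w = curvature nabla y u v w + curvature nabla y u' v w := by
  obtain ⟨U, hU, hy, -, -, hw, -⟩ := exists_smoothFieldOn_extensions u v w w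
  exact ((tensorialAt_curvatureField_left h hU hy _ hw).mkHom _ _).map_add u u'

lemma curvature_smul_left (h : IsLeviCivita nabla) (a : ℝ) (u v w : TangentSpace I y) :
    curvature nabla y (a • u) v w = a • curvature nabla y u v w := by
  obtain ⟨U, hU, hy, -, -, hw, -⟩ := exists_smoothFieldOn_extensions u v w w
  exact ((tensorialAt_curvatureField_left h hU hy _ hw).mkHom _ _).map_smul a u

/-- The bilinear form `(v, w) ↦ g(R(z, v)w, z')`. -/
noncomputable def curvatureBilin (h : IsLeviCivita nabla) (z z' : TangentSpace I y) :
    TangentSpace I y →ₗ[ℝ] TangentSpace I y →ₗ[ℝ] ℝ :=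
  LinearMap.mk₂ ℝ (fun v w => inner ℝ (curvature nabla y z v w) z')
    (fun v v' w => by
      rw [curvature_swap, curvature_swap v, curvature_swap v', curvature_add_left h]
      simp [inner_add_left, add_comm])
    (fun a v w => by
      rw [curvature_swap, curvature_swap v, curvature_smul_left h]
      simp [inner_smul_left])
    (fun v w w' => by
      rw [inner_curvature_swap h, inner_curvature_swap h _ _ w, inner_curvature_swap h _ _ w',
        inner_add_right]
      ring)
    (fun a v w => by
      rw [inner_curvature_swap h, inner_curvature_swap h _ _ w, inner_smul_right]
      simp)

/-- The bilinear form `(z, z') ↦ g(R(z, v)w, z')`. -/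
noncomputable def curvatureBilin' (h : IsLeviCivita nabla) (v w : TangentSpace I y) :
    TangentSpace I y →ₗ[ℝ] TangentSpace I y →ₗ[ℝ] ℝ :=
  LinearMap.mk₂ ℝ (fun z z' => inner ℝ (curvature nabla y z v w) z')
    (fun z z' w => by rw [curvature_add_left h, inner_add_left])
    (fun a z w => by rw [curvature_smul_left h]; simp [inner_smul_left])
    (fun z w w' => by rw [inner_add_right])
    (fun a z w => by rw [inner_smul_right]; simp)

/-- The double trace of the curvature over a subspace does not depend on the orthonormal basis. -/
lemma sum_inner_curvature_eq (h : IsLeviCivita nabla) {ι κ : Type*} [Fintype ι] [Fintype κ]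
    {b : ι → TangentSpace I y} {c : κ → TangentSpace I y}
    (hb : Orthonormal ℝ b) (hc : Orthonormal ℝ c)
    (hs : Submodule.span ℝ (range b) = Submodule.span ℝ (range c)) :
    ∑ i, ∑ i', inner ℝ (curvature nabla y (b i') (b i) (b i)) (b i')
      = ∑ j, ∑ j', inner ℝ (curvature nabla y (c j') (c j) (c j)) (c j') := by
  calc _ = ∑ i, ∑ j', inner ℝ (curvature nabla y (c j') (b i) (b i)) (c j') :=
        Finset.sum_congr rfl fun i _ =>
          hb.sum_bilin_eq_of_span_eq hc hs (curvatureBilin' h (b i) (b i))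
    _ = ∑ j', ∑ i, inner ℝ (curvature nabla y (c j') (b i) (b i)) (c j') := Finset.sum_comm
    _ = ∑ j', ∑ j, inner ℝ (curvature nabla y (c j') (c j) (c j)) (c j') :=
        Finset.sum_congr rfl fun j' _ =>
          hb.sum_bilin_eq_of_span_eq hc hs (curvatureBilin h (c j') (c j'))
    _ = _ := Finset.sum_comm

/-- The scalar curvature in an arbitrary orthonormal basis. -/
lemma scalarCurvature_eq_sum (h : IsLeviCivita nabla) {κ : Type*} [Fintype κ]
    {c : κ → TangentSpace I y} (hc : Orthonormal ℝ c) (hs : Submodule.span ℝ (range c) = ⊤) :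
    scalarCurvature nabla y
      = ∑ j, ∑ j', inner ℝ (curvature nabla y (c j') (c j) (c j)) (c j') := by
  have : FiniteDimensional ℝ (TangentSpace I y) := inferInstanceAs (FiniteDimensional ℝ E)
  refine sum_inner_curvature_eq h (stdOrthonormalBasis ℝ (TangentSpace I y)).orthonormal hc ?_
  rw [hs, ← OrthonormalBasis.coe_toBasis, Module.Basis.span_eq]

lemma inner_proj {K : Submodule ℝ (TangentSpace I y)} (v : TangentSpace I y)
    {w : TangentSpace I y} (hw : w ∈ K) : inner ℝ (proj K v) w = inner ℝ v w := by
  have : FiniteDimensional ℝ (TangentSpace I y) := inferInstanceAs (FiniteDimensional ℝ E)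
  rw [proj, Submodule.inner_starProjection_left_eq_right,
    Submodule.starProjection_eq_self_iff.2 hw]

lemma proj_mem (K : Submodule ℝ (TangentSpace I y)) (v : TangentSpace I y) : proj K v ∈ K := by
  have : FiniteDimensional ℝ (TangentSpace I y) := inferInstanceAs (FiniteDimensional ℝ E)
  exact Submodule.starProjection_apply_mem K v

lemma proj_add_proj_orthogonal (K : Submodule ℝ (TangentSpace I y)) (v : TangentSpace I y) :
    proj K v + proj Kᗮ v = v := by
  have : FiniteDimensional ℝ (TangentSpace I y) := inferInstanceAs (FiniteDimensional ℝ E)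
  exact Submodule.starProjection_add_starProjection_orthogonal v

/-- The scalar curvature of a distribution in an arbitrary orthonormal basis. -/
lemma scalarCurvatureOf_eq_sum (h : IsLeviCivita nabla) {κ : Type*} [Fintype κ]
    {K : Submodule ℝ (TangentSpace I y)} {c : κ → TangentSpace I y} (hc : Orthonormal ℝ c)
    (hs : Submodule.span ℝ (range c) = K) :
    scalarCurvatureOf nabla K
      = ∑ j, ∑ j', inner ℝ (curvature nabla y (c j') (c j) (c j)) (c j') := by
  have : FiniteDimensional ℝ (TangentSpace I y) := inferInstanceAs (FiniteDimensional ℝ E)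
  have hb := (stdOrthonormalBasis ℝ K).orthonormal.comp_linearIsometry K.subtypeₗᵢ
  have hspan : Submodule.span ℝ (range (K.subtypeₗᵢ ∘ stdOrthonormalBasis ℝ K))
      = Submodule.span ℝ (range c) := by
    rw [hs, range_comp]
    have := (stdOrthonormalBasis ℝ K).toBasis.span_eq
    rw [OrthonormalBasis.coe_toBasis] at this
    change Submodule.span ℝ (K.subtype '' _) = K
    rw [← Submodule.map_span, this, Submodule.map_subtype_top]
  rw [← sum_inner_curvature_eq h hb hc hspan]
  refine Finset.sum_congr rfl fun i _ => Finset.sum_congr rfl fun i' _ => ?_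
  exact inner_proj _ (Subtype.coe_prop _)

end CurvatureForm

section Distributions

open VectorField

variable {E : Type*} [NormedAddCommGroup E] [NormedSpace ℝ E] [FiniteDimensional ℝ E]
  {H : Type*} [TopologicalSpace H] {I : ModelWithCorners ℝ E H}
  {N : Type*} [TopologicalSpace N] [ChartedSpace H N] [IsManifold I ∞ N]
  [RiemannianBundle (fun y : N => TangentSpace I y)]
  [IsContMDiffRiemannianBundle I ∞ E (fun y : N => TangentSpace I y)]
  {nabla : CovariantDerivative I E (fun y : N => TangentSpace I y)}
  {U : Set N} {y : N} {X Y V W : VField I N} {D K : Distribution I N}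
  {ι κ : Type*} [Fintype ι] [Fintype κ] {f : ι → VField I N} {e : κ → VField I N}

lemma proj_eq_sum {L : Submodule ℝ (TangentSpace I y)} {b : ι → TangentSpace I y}
    (hb : Orthonormal ℝ b) (hs : Submodule.span ℝ (range b) = L) (v : TangentSpace I y) :
    proj L v = ∑ i, (inner ℝ (b i) v : ℝ) • b i := by
  have hv : proj L v ∈ Submodule.span ℝ (range b) := hs ▸ proj_mem L v
  rw [← hb.sum_inner_smul_of_mem_span hv]
  refine Finset.sum_congr rfl fun i _ => ?_
  rw [real_inner_comm, inner_proj v (hs ▸ Submodule.subset_span (mem_range_self i)),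
    real_inner_comm]

lemma IsOrthonormalFrameOn.mem (he : IsOrthonormalFrameOn e K U) (hy : y ∈ U) (k : κ) :
    e k y ∈ K y :=
  he.span_eq y hy ▸ Submodule.subset_span (mem_range_self k)

/-- The orthogonal projection of a smooth field to a distribution with a smooth frame is smooth. -/
lemma IsOrthonormalFrameOn.smoothFieldOn_proj (he : IsOrthonormalFrameOn e K U)
    (hX : SmoothFieldOn X U) : SmoothFieldOn (fun y => proj (K y) (X y)) U :=
  (SmoothFieldOn.sum fun k => (he.smooth k).smul ((he.smooth k).ip hX)).congr fun y hy =>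
    proj_eq_sum (he.orthonormal y hy) (he.span_eq y hy) (X y)

lemma smoothFieldOn_shape (h : IsLeviCivita nabla) (hU : IsOpen U)
    (hf : IsOrthonormalFrameOn f D U) (hV : SmoothFieldOn V U) (hX : SmoothFieldOn X U) :
    SmoothFieldOn (shape nabla D V X) U :=
  (hf.smoothFieldOn_proj (h.smoothFieldOn_covD hU hX hV)).neg

lemma smoothFieldOn_covDPerp (h : IsLeviCivita nabla) (hU : IsOpen U)
    (he : IsOrthonormalFrameOn e (orthCompl D) U) (hX : SmoothFieldOn X U)
    (hV : SmoothFieldOn V U) : SmoothFieldOn (covDPerp nabla D X V) U :=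
  he.smoothFieldOn_proj (h.smoothFieldOn_covD hU hX hV)

lemma shape_mem (V X : VField I N) (y : N) : shape nabla D V X y ∈ D y :=
  (D y).neg_mem (proj_mem _ _)

lemma covDPerp_mem (X V : VField I N) (y : N) : covDPerp nabla D X V y ∈ (D y)ᗮ :=
  proj_mem _ _

lemma inner_shape {w : TangentSpace I y} (hw : w ∈ D y) :
    inner ℝ (shape nabla D V X y) w = - inner ℝ (nabla V y (X y)) w := by
  rw [shape, inner_neg_left, inner_proj _ hw]
  rfl

/-- The Weingarten decomposition of `∇_X V`. -/
lemma covD_eq_neg_shape_add_covDPerp (X V : VField I N) :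
    covD nabla X V = (fun y => - shape nabla D V X y) + covDPerp nabla D X V := by
  ext1 y
  simp only [Pi.add_apply, shape, covDPerp, neg_neg]
  exact (proj_add_proj_orthogonal (D y) _).symm

/-- Differentiation of an orthogonality relation. -/
lemma inner_nabla_left_of_orthogonal (h : IsLeviCivita nabla) (hU : IsOpen U) (hy : y ∈ U)
    (hX : SmoothFieldOn X U) (hY : SmoothFieldOn Y U) (hXY : ∀ z ∈ U, inner ℝ (X z) (Y z) = 0)
    (v : TangentSpace I y) :
    inner ℝ (nabla X y v) (Y y) = - inner ℝ (X y) (nabla Y y v) := by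
  have h0 : ip X Y =ᶠ[𝓝 y] fun _ => (0 : ℝ) := by
    filter_upwards [hU.mem_nhds hy] with z hz using hXY z hz
  have h1 : mvfderiv I (ip X Y) y v = 0 := by
    have h2 := DFunLike.congr_fun (h0.mfderiv_eq (I := I) (I' := 𝓘(ℝ))) v
    rw [mfderiv_const] at h2
    exact h2
  rw [h.mvfderiv_ip (hX.mdifferentiableAt hU hy) (hY.mdifferentiableAt hU hy)] at h1
  linarith

/-- The shape operator of a normal field is symmetric at the points where the brackets of a frame
of the distribution are tangent to the distribution. -/
lemma inner_nabla_symm (h : IsLeviCivita nabla) (hU : IsOpen U) (hy : y ∈ U)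
    (hf : IsOrthonormalFrameOn f D U)
    (hbr : ∀ i j, mlieBracket I (f i) (f j) y ∈ D y) (hV : SmoothFieldOn V U)
    (hVD : ∀ z ∈ U, V z ∈ (D z)ᗮ) {u v : TangentSpace I y} (hu : u ∈ D y) (hv : v ∈ D y) :
    inner ℝ (nabla V y u) v = inner ℝ (nabla V y v) u := by
  have hfV (i j) : inner ℝ (nabla V y (f i y)) (f j y) = - inner ℝ (V y) (nabla (f j) y (f i y)) :=
    inner_nabla_left_of_orthogonal h hU hy hV (hf.smooth j)
      (fun z hz => (Submodule.mem_orthogonal' _ _).1 (hVD z hz) _ (hf.mem hz j)) _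
  have hframe (i j) : inner ℝ (nabla V y (f i y)) (f j y) = inner ℝ (nabla V y (f j y)) (f i y) := by
    have hb : inner ℝ (V y) (mlieBracket I (f i) (f j) y) = 0 :=
      (Submodule.mem_orthogonal' _ _).1 (hVD y hy) _ (hbr i j)
    rw [← h.covD_sub_covD ((hf.smooth i).mdifferentiableAt hU hy)
      ((hf.smooth j).mdifferentiableAt hU hy), inner_sub_right] at hb
    rw [hfV, hfV]
    simp only [covD] at hb
    linarith
  rw [← hf.span_eq y hy] at hu hv
  induction hu using Submodule.span_induction with
  | mem u hu =>
    obtain ⟨i, rfl⟩ := hu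
    induction hv using Submodule.span_induction with
    | mem v hv =>
      obtain ⟨j, rfl⟩ := hv
      exact hframe i j
    | zero => simp
    | add v v' _ _ h1 h2 => simp [inner_add_left, inner_add_right, h1, h2]
    | smul a v _ h1 => simp [inner_smul_left, inner_smul_right, h1]
  | zero => simp
  | add u u' _ _ h1 h2 => simp [inner_add_left, inner_add_right, h1, h2]
  | smul a u _ h1 => simp [inner_smul_left, inner_smul_right, h1]

/-- When `D^⊥` is totally geodesic, `D` is parallel along `D^⊥`. -/
lemma TotallyGeodesicAlong.covD_mem (h : IsLeviCivita nabla) (hU : IsOpen U) {A : Set N}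
    (hgeod : TotallyGeodesicAlong nabla (orthCompl D) U A) (hyA : y ∈ A) (hy : y ∈ U)
    (he : IsOrthonormalFrameOn e (orthCompl D) U)
    (hX : SmoothFieldOn X U) (hXD : ∀ z ∈ U, X z ∈ D z)
    (hV : SmoothFieldOn V U) (hVD : ∀ z ∈ U, V z ∈ (D z)ᗮ) : covD nabla V X y ∈ D y := by
  have : FiniteDimensional ℝ (TangentSpace I y) := inferInstanceAs (FiniteDimensional ℝ E)
  rw [← Submodule.orthogonal_orthogonal (D y), Submodule.mem_orthogonal']
  intro w hw
  change w ∈ orthCompl D y at hw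
  rw [← he.span_eq y hy] at hw
  induction hw using Submodule.span_induction with
  | mem w hw =>
    obtain ⟨k, rfl⟩ := hw
    have h1 := inner_nabla_left_of_orthogonal h hU hy hX (he.smooth k)
      (fun z hz => (Submodule.mem_orthogonal _ _).1 (he.mem hz k) _ (hXD z hz)) (V y)
    have h2 := hgeod V (e k) hV (he.smooth k) hVD (fun z hz => he.mem hz k) y hyA
    have h3 := (Submodule.mem_orthogonal _ _).1 h2 _ (hXD y hy)
    simp only [covD] at h3 ⊢
    rw [h1, h3, neg_zero]
  | zero => simp
  | add v v' _ _ h1 h2 => rw [inner_add_right, h1, h2, add_zero]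
  | smul a v _ h1 => rw [inner_smul_right, h1, mul_zero]

/-- The mixed curvature `g(R(X, V)V, X)` for a section `X` of `D` and a section `V` of a totally
geodesic complement `D^⊥`. -/
theorem inner_curvature_mixed (h : IsLeviCivita nabla) (hU : IsOpen U) {A : Set N}
    (hgeod : TotallyGeodesicAlong nabla (orthCompl D) U A) (hyA : y ∈ A) (hy : y ∈ U)
    (hf : IsOrthonormalFrameOn f D U) (he : IsOrthonormalFrameOn e (orthCompl D) U)
    (hbr : ∀ i j, mlieBracket I (f i) (f j) y ∈ D y)
    (hX : SmoothFieldOn X U) (hXD : ∀ z ∈ U, X z ∈ D z)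
    (hV : SmoothFieldOn V U) (hVD : ∀ z ∈ U, V z ∈ (D z)ᗮ)
    (hder : mvfderiv I (ip (covD nabla V V) X) y (X y) = 0) :
    inner ℝ (curvature nabla y (X y) (V y) (V y)) (X y)
      = - ip (shape nabla D (covDPerp nabla D V V) X) X y
        + ip (covD nabla V (shape nabla D V X)) X y
        - ip (shape nabla D V X) (shape nabla D V X) y
        - ip (covD nabla V X) (shape nabla D V X) y := by
  have hS := smoothFieldOn_shape h hU hf hV hX
  have hT := smoothFieldOn_covDPerp h hU he hX hV
  have hW := smoothFieldOn_covDPerp h hU he hV hV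
  have hVV := h.smoothFieldOn_covD hU hV hV
  have hXy := hXD y hy
  -- the term `∇_X ∇_V V`
  have hWeq : covDPerp nabla D V V y = covD nabla V V y := by
    have hmem : covD nabla V V y ∈ (D y)ᗮ := hgeod V V hV hV hVD hVD y hyA
    have : FiniteDimensional ℝ (TangentSpace I y) := inferInstanceAs (FiniteDimensional ℝ E)
    exact Submodule.starProjection_eq_self_iff.2 hmem
  have h1 : inner ℝ (nabla (covD nabla V V) y (X y)) (X y)
      = - ip (shape nabla D (covDPerp nabla D V V) X) X y := by
    rw [h.mvfderiv_ip (hVV.mdifferentiableAt hU hy) (hX.mdifferentiableAt hU hy)] at hder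
    have h2 := inner_nabla_left_of_orthogonal h hU hy hW hX
      (fun z hz => (Submodule.mem_orthogonal' _ _).1 (covDPerp_mem V V z) _ (hXD z hz)) (X y)
    rw [hWeq] at h2
    rw [ip, inner_shape hXy, h2]
    linarith
  -- the term `∇_V ∇_X V`
  have h2 : inner ℝ (nabla (covD nabla X V) y (V y)) (X y)
      = - ip (covD nabla V (shape nabla D V X)) X y := by
    have hTD : inner ℝ (nabla (covDPerp nabla D X V) y (V y)) (X y) = 0 :=
      (Submodule.mem_orthogonal' _ _).1
        (hgeod V _ hV hT hVD (fun z _ => covDPerp_mem X V z) y hyA) _ hXy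
    have hneg : nabla (fun y => - shape nabla D V X y) y = - nabla (shape nabla D V X) y := by
      have hsmul := nabla.isCovariantDerivativeOnUniv.smul_const (-1 : ℝ)
        (hS.mdifferentiableAt hU hy)
      rw [neg_one_smul, neg_one_smul] at hsmul
      exact hsmul
    rw [covD_eq_neg_shape_add_covDPerp (D := D) X V,
      nabla_add (hS.neg.mdifferentiableAt hU hy) (hT.mdifferentiableAt hU hy), hneg,
      add_apply, inner_add_left, hTD, add_zero, neg_apply, inner_neg_left]
    rfl
  -- the term `∇_{[X, V]} V`
  have h3 : inner ℝ (nabla V y (mlieBracket I X V y)) (X y)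
      = ip (shape nabla D V X) (shape nabla D V X) y
        + ip (covD nabla V X) (shape nabla D V X) y := by
    have hTD : inner ℝ (nabla V y (covDPerp nabla D X V y)) (X y) = 0 :=
      (Submodule.mem_orthogonal' _ _).1
        (hgeod _ V hT hV (fun z _ => covDPerp_mem X V z) hVD y hyA) _ hXy
    have hVX := hgeod.covD_mem h hU hyA hy he hX hXD hV hVD
    have hSD := shape_mem (nabla := nabla) (D := D) V X y
    rw [← h.covD_sub_covD (hX.mdifferentiableAt hU hy) (hV.mdifferentiableAt hU hy),
      covD_eq_neg_shape_add_covDPerp (D := D) X V, Pi.add_apply, map_sub, map_add, map_neg,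
      inner_sub_left, inner_add_left, inner_neg_left, hTD,
      inner_nabla_symm h hU hy hf hbr hV hVD hSD hXy,
      inner_nabla_symm h hU hy hf hbr hV hVD hVX hXy, ip, ip,
      ← real_inner_comm (covD nabla V X y), inner_shape hSD, inner_shape hVX]
    ring
  rw [curvature_eq_curvatureField h hU hy hX hV hV, curvatureField_apply, inner_sub_left,
    inner_sub_left, h1, h2, h3]
  ring

/-- The scalar curvature, decomposed along a distribution and its orthogonal complement. -/
lemma scalarCurvature_eq_add (h : IsLeviCivita nabla) {K : Submodule ℝ (TangentSpace I y)}
    {b : ι → TangentSpace I y} {c : κ → TangentSpace I y}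
    (hb : Orthonormal ℝ b) (hbs : Submodule.span ℝ (range b) = K)
    (hc : Orthonormal ℝ c) (hcs : Submodule.span ℝ (range c) = Kᗮ) :
    scalarCurvature nabla y = scalarCurvatureOf nabla K + scalarCurvatureOf nabla Kᗮ
      + 2 * ∑ j, ∑ k, inner ℝ (curvature nabla y (b j) (c k) (c k)) (b j) := by
  have : FiniteDimensional ℝ (TangentSpace I y) := inferInstanceAs (FiniteDimensional ℝ E)
  have hbc (j k) : inner ℝ (b j) (c k) = 0 :=
    (Submodule.mem_orthogonal K _).1 (hcs ▸ Submodule.subset_span (mem_range_self k)) _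
      (hbs ▸ Submodule.subset_span (mem_range_self j))
  have horth : Orthonormal ℝ (Sum.elim b c) := by
    refine ⟨?_, ?_⟩
    · rintro (j | k)
      exacts [hb.1 j, hc.1 k]
    · rintro (j | k) (j' | k') hne
      · exact hb.2 fun hjj => hne (congrArg _ hjj)
      · exact hbc j k'
      · exact (real_inner_comm _ _).trans (hbc j' k)
      · exact hc.2 fun hkk => hne (congrArg _ hkk)
  have hspan : Submodule.span ℝ (range (Sum.elim b c)) = ⊤ := by
    rw [Sum.elim_range, Submodule.span_union, hbs, hcs]
    exact Submodule.sup_orthogonal_of_hasOrthogonalProjection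
  have hswap (j k) : inner ℝ (curvature nabla y (c k) (b j) (b j)) (c k)
      = inner ℝ (curvature nabla y (b j) (c k) (c k)) (b j) := by
    rw [curvature_swap, inner_neg_left, inner_curvature_swap h, neg_neg]
  rw [scalarCurvature_eq_sum h horth hspan, scalarCurvatureOf_eq_sum h hb hbs,
    scalarCurvatureOf_eq_sum h hc hcs]
  simp only [Fintype.sum_sum_type, Sum.elim_inl, Sum.elim_inr, hswap, Finset.sum_add_distrib]
  rw [Finset.sum_comm (s := (Finset.univ : Finset κ)) (t := (Finset.univ : Finset ι))]
  ring

end Distributions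

end RiemMap

open RiemMap in
theorem theorem3p4 {m n : ℕ}
    -- the Riemannian manifolds
    {M : Type*} [TopologicalSpace M] [ChartedSpace (EuclideanSpace ℝ (Fin m)) M]
    [IsManifold (𝓡 m) ∞ M]
    [RiemannianBundle (fun x : M => TangentSpace (𝓡 m) x)]
    [IsContMDiffRiemannianBundle (𝓡 m) ∞ (EuclideanSpace ℝ (Fin m))
      (fun x : M => TangentSpace (𝓡 m) x)]
    {N : Type*} [TopologicalSpace N] [ChartedSpace (EuclideanSpace ℝ (Fin n)) N]
    [IsManifold (𝓡 n) ∞ N]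
    [RiemannianBundle (fun y : N => TangentSpace (𝓡 n) y)]
    [IsContMDiffRiemannianBundle (𝓡 n) ∞ (EuclideanSpace ℝ (Fin n))
      (fun y : N => TangentSpace (𝓡 n) y)]
    -- the Levi-Civita connection of the target
    (nabla : CovariantDerivative (𝓡 n) (EuclideanSpace ℝ (Fin n))
      (fun y : N => TangentSpace (𝓡 n) y))
    (hnabla : IsLeviCivita nabla)
    -- the Riemannian map
    (F : M → N) (hF : IsRiemannianMap (𝓡 m) (𝓡 n) F)
    -- the range of the differential, over an open set of the source, seen as a
    -- distribution on an open set of the target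
    (O : Set M) (hO : IsOpen O) (U : Set N) (hU : IsOpen U) (hOU : MapsTo F O U)
    (D : Distribution (𝓡 n) N)
    (hD : ∀ q ∈ O, D (F q) = (diffMap (𝓡 m) (𝓡 n) F q).range)
    -- its orthogonal complement is totally geodesic
    (hgeod : TotallyGeodesicAlong nabla (orthCompl D) U (F '' O))
    -- the orthonormal frames; `FX j` is the field `F_* X_j`
    {r n₁ : ℕ} (X : Fin (m - r) → VField (𝓡 m) M)
    (hX : ∀ j, SmoothFieldOn (X j) O)
    (hXhor : ∀ j, ∀ q ∈ O, X j q ∈ (diffMap (𝓡 m) (𝓡 n) F q).kerᗮ)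
    (FX : Fin (m - r) → VField (𝓡 n) N)
    (hFX : ∀ j, ∀ q ∈ O, FX j (F q) = diffMap (𝓡 m) (𝓡 n) F q (X j q))
    (hFXframe : IsOrthonormalFrameOn FX D U)
    (e : Fin n₁ → VField (𝓡 n) N)
    (he : IsOrthonormalFrameOn e (orthCompl D) U)
    (p : M) (hp : p ∈ O) :
    scalarCurvature nabla (F p)
      = scalarCurvatureOf nabla (diffMap (𝓡 m) (𝓡 n) F p).range
        + scalarCurvatureOf nabla (diffMap (𝓡 m) (𝓡 n) F p).rangeᗮ
        - 2 * ∑ j, ∑ k, ip (shape nabla D (covDPerp nabla D (e k) (e k)) (FX j)) (FX j) (F p)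
        + ∑ j, ∑ k, ip (covD nabla (e k) (shape nabla D (e k) (FX j))) (FX j) (F p)
        - 2 * ∑ j, ∑ k, ip (shape nabla D (e k) (FX j)) (shape nabla D (e k) (FX j)) (F p)
        - 3 * ∑ j, ∑ k, ip (covD nabla (e k) (FX j)) (shape nabla D (e k) (FX j)) (F p)
        + ∑ j, ∑ k, dirDeriv (e k) (ip (shape nabla D (e k) (FX j)) (FX j)) (F p) := by
  have hFp : F p ∈ U := hOU hp
  have hXD (j) : ∀ z ∈ U, FX j z ∈ D z := fun z hz => hFXframe.mem hz j
  have heD (k) : ∀ z ∈ U, e k z ∈ (D z)ᗮ := fun z hz => he.mem hz k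
  have hFsmooth : ContMDiffAt (𝓡 m) (𝓡 n) 2 F p :=
    (hF.smooth p).of_le ENat.LEInfty.out
  have hrel (j) : ∀ᶠ q in 𝓝 p, FX j (F q) = mfderiv (𝓡 m) (𝓡 n) F q (X j q) := by
    filter_upwards [hO.mem_nhds hp] with q hq using hFX j q hq
  have hbr (i j) : VectorField.mlieBracket (𝓡 n) (FX i) (FX j) (F p) ∈ D (F p) := by
    rw [hD p hp, mlieBracket_eq_mfderiv_mlieBracket_of_related hFsmooth
      ((hX i).mdifferentiableAt hO hp) ((hX j).mdifferentiableAt hO hp)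
      ((hFXframe.smooth i).mdifferentiableAt hU hFp) ((hFXframe.smooth j).mdifferentiableAt hU hFp)
      (hrel i) (hrel j)]
    exact LinearMap.mem_range_self _ _
  -- `∇_V V` is orthogonal to `D` along the image of `F`, to which the frame of `D` is tangent
  have hder (j k) : mvfderiv (𝓡 n) (ip (covD nabla (e k) (e k)) (FX j)) (F p) (FX j (F p)) = 0 := by
    set g := ip (covD nabla (e k) (e k)) (FX j)
    have hg : MDifferentiableAt (𝓡 n) 𝓘(ℝ) g (F p) :=
      mdifferentiableAt_ip
        ((hnabla.smoothFieldOn_covD hU (he.smooth k) (he.smooth k)).mdifferentiableAt hU hFp)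
        ((hFXframe.smooth j).mdifferentiableAt hU hFp)
    have hg0 : g ∘ F =ᶠ[𝓝 p] fun _ => (0 : ℝ) := by
      filter_upwards [hO.mem_nhds hp] with q hq
      exact (Submodule.mem_orthogonal' _ _).1
        (hgeod (e k) (e k) (he.smooth k) (he.smooth k) (heD k) (heD k) (F q) ⟨q, hq, rfl⟩) _
        (hXD j _ (hOU hq))
    have hd0 : mvfderiv (𝓡 m) (g ∘ F) p (X j p) = 0 := by
      have h2 := DFunLike.congr_fun (hg0.mfderiv_eq (I := 𝓡 m) (I' := 𝓘(ℝ))) (X j p)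
      rw [mfderiv_const] at h2
      exact h2
    rw [mvfderiv_comp p hg (hFsmooth.mdifferentiableAt two_ne_zero)] at hd0
    rw [hFX j p hp]
    exact hd0
  have hmixed (j k) := inner_curvature_mixed hnabla hU hgeod ⟨p, hp, rfl⟩ hFp hFXframe he hbr
    (hFXframe.smooth j) (hXD j) (he.smooth k) (heD k) (hder j k)
  have hdir (j k) : dirDeriv (e k) (ip (shape nabla D (e k) (FX j)) (FX j)) (F p)
      = ip (covD nabla (e k) (shape nabla D (e k) (FX j))) (FX j) (F p)
        + ip (covD nabla (e k) (FX j)) (shape nabla D (e k) (FX j)) (F p) := by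
    rw [dirDeriv, hnabla.mvfderiv_ip
      ((smoothFieldOn_shape hnabla hU hFXframe (he.smooth k)
        (hFXframe.smooth j)).mdifferentiableAt hU hFp)
      ((hFXframe.smooth j).mdifferentiableAt hU hFp), real_inner_comm (nabla (FX j) _ _)]
    rfl
  rw [← hD p hp, scalarCurvature_eq_add hnabla (hFXframe.orthonormal _ hFp)
    (hFXframe.span_eq _ hFp) (he.orthonormal _ hFp) (he.span_eq _ hFp)]
  simp only [hmixed, hdir, Finset.sum_add_distrib, Finset.sum_sub_distrib, Finset.sum_neg_distrib]
  ring
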